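/- Let $G=(V,E)$ be a simple undirected graph on $V=\{0,\dots,n-1\}$ with non-negative real edge capacities $w(e)$, and let $S\subseteq V$ be a Steiner set, i.e. $|S|\ge 2$. A Steiner cut is a set $C\subset V$ such that some vertex of $S$ lies in $C$ and some vertex of $S$ lies outside $C$; its capacity is the sum of the capacities of the edges with exactly one endpoint in $C$; an $S$-mincut is a Steiner cut of least capacity. The machine model is the word RAM with words of $O(\log n)$ bits, equipped with additional cells for real numbers, which can be copied, added, subtracted and compared in unit time. Space is the number of (word or real) cells; each instruction, including the output of one vertex or one real number, takes unit time. Theorem. For every such $G$ and every Steiner set $S$ there exists a data structure occupying $O(n^2)$ space that, given the endpoints of any edge $e\in E$, reports, for the graph $G\setminus\{e\}$ obtained by the failure of $e$, an $S$-mincut $C$ (as a list of its vertices without repetition) in $O(|C|)$ time, and the capacity of $C$ in $G\setminus\{e\}$ in $O(1)$ time. The two query programs and the constants hidden in the $O$-notation are the same for all $n$, $G$, $w$, $S$ and $e$. -/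

import Mathlib

/-! ### Cuts in weighted graphs -/

namespace SteinerCut

variable {V : Type*}

/-- The edge `e` contributes to the cut `C`: exactly one of its endpoints lies in `C`. -/
def Contributes (e : Sym2 V) (C : Finset V) : Prop :=
  ∃ u v : V, e = s(u, v) ∧ u ∈ C ∧ v ∉ C

open Classical in
/-- The capacity of `C` in the graph `G`: the sum of `w e` over all edges `e` of `G` that contribute
to `C`. Values of `w` outside the edge set of `G` play no role. -/
noncomputable def capacity [Fintype V] (G : SimpleGraph V) (w : Sym2 V → ℝ) (C : Finset V) : ℝ :=
  ∑ e ∈ (Finset.univ : Finset (Sym2 V)).filter (fun e => e ∈ G.edgeSet ∧ Contributes e C), w e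

/-- `C` is a Steiner cut for `S`: some vertex of `S` lies in `C` and some vertex of `S` lies
outside. (Hence `C` is nonempty and is not the whole vertex set.) -/
def IsSteinerCut (S C : Finset V) : Prop :=
  ∃ s ∈ S, ∃ s' ∈ S, s ∈ C ∧ s' ∉ C

/-- `C` is an `S`-mincut of the weighted graph `(G, w)`: a Steiner cut of least capacity. -/
def IsMincut [Fintype V] (G : SimpleGraph V) (w : Sym2 V → ℝ) (S C : Finset V) : Prop :=
  IsSteinerCut S C ∧ ∀ C' : Finset V, IsSteinerCut S C' → capacity G w C ≤ capacity G w C'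

end SteinerCut

/-! ### The machine: a word RAM with additional cells for real numbers

Integer cells hold words of `b` bits, that is, naturals below `2 ^ b`. Real cells hold capacities,
which may only be copied, added, subtracted and compared; a real is never turned into a word.
Every instruction takes one unit of time. -/

namespace RealRAM

/-- Instructions. Numerals are indices of registers, except for the constant of `const` and
the jump targets `l`, which are positions in the program. -/
inductive Instr where
  /-- put a constant into word register `d` -/
  | const (d k : ℕ)
  /-- copy word register `a` to word register `d` -/
  | move (d a : ℕ)
  | add (d a b : ℕ)
  | sub (d a b : ℕ)
  | mul (d a b : ℕ)
  | div (d a b : ℕ)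
  /-- put the word cell whose address is in word register `a` into word register `d` -/
  | load (d a : ℕ)
  /-- write word register `c` to the word cell whose address is in word register `a` -/
  | store (a c : ℕ)
  /-- copy real register `a` to real register `d` -/
  | rmove (d a : ℕ)
  | radd (d a b : ℕ)
  | rsub (d a b : ℕ)
  /-- put the real cell whose address is in word register `a` into real register `d` -/
  | rload (d a : ℕ)
  /-- write real register `c` to the real cell whose address is in word register `a` -/
  | rstore (a c : ℕ)
  /-- go to `l` -/
  | jump (l : ℕ)
  /-- go to `l` if word register `a` equals word register `b` -/
  | jumpEq (a b l : ℕ)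
  /-- go to `l` if word register `a` is less than word register `b` -/
  | jumpLt (a b l : ℕ)
  /-- go to `l` if real register `a` is less than real register `b` -/
  | rjumpLt (a b l : ℕ)
  /-- append word register `a` to the output -/
  | emit (a : ℕ)
  /-- append real register `a` to the real output -/
  | remit (a : ℕ)

/-- A program is a finite list of instructions; it halts when control leaves the list. -/
abbrev Program := List Instr

/-- The configuration of the machine: program counter, registers, memory, and what has been output
so far, for words and for reals. -/
structure State where
  pc : ℕ
  wreg : ℕ → ℕ
  rreg : ℕ → ℝ
  wmem : ℕ → ℕ
  rmem : ℕ → ℝ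
  wout : List ℕ
  rout : List ℝ

namespace State

/-- Put a word into register `d`, keeping its `b` low bits, and go on to the next instruction. -/
def setW (b : ℕ) (s : State) (d v : ℕ) : State :=
  { s with pc := s.pc + 1, wreg := Function.update s.wreg d (v % 2 ^ b) }

/-- Put a real into real register `d` and go on to the next instruction. -/
noncomputable def setR (s : State) (d : ℕ) (v : ℝ) : State :=
  { s with pc := s.pc + 1, rreg := Function.update s.rreg d v }

open Classical in
/-- Go to `l` if `p` holds, otherwise to the next instruction. -/
noncomputable def branch (s : State) (p : Prop) (l : ℕ) : State :=
  { s with pc := if p then l else s.pc + 1 }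

end State

/-- The effect of one instruction on words of `b` bits; word arithmetic is modulo `2 ^ b`. -/
noncomputable def exec (b : ℕ) (s : State) : Instr → State
  | .const d k => s.setW b d k
  | .move d a => s.setW b d (s.wreg a)
  | .add d a c => s.setW b d (s.wreg a + s.wreg c)
  | .sub d a c => s.setW b d (s.wreg a + 2 ^ b - s.wreg c)
  | .mul d a c => s.setW b d (s.wreg a * s.wreg c)
  | .div d a c => s.setW b d (s.wreg a / s.wreg c)
  | .load d a => s.setW b d (s.wmem (s.wreg a))
  | .store a c =>
      { s with pc := s.pc + 1, wmem := Function.update s.wmem (s.wreg a) (s.wreg c) }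
  | .rmove d a => s.setR d (s.rreg a)
  | .radd d a c => s.setR d (s.rreg a + s.rreg c)
  | .rsub d a c => s.setR d (s.rreg a - s.rreg c)
  | .rload d a => s.setR d (s.rmem (s.wreg a))
  | .rstore a c =>
      { s with pc := s.pc + 1, rmem := Function.update s.rmem (s.wreg a) (s.rreg c) }
  | .jump l => { s with pc := l }
  | .jumpEq a c l => s.branch (s.wreg a = s.wreg c) l
  | .jumpLt a c l => s.branch (s.wreg a < s.wreg c) l
  | .rjumpLt a c l => s.branch (s.rreg a < s.rreg c) l
  | .emit a => { s with pc := s.pc + 1, wout := s.wout ++ [s.wreg a] }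
  | .remit a => { s with pc := s.pc + 1, rout := s.rout ++ [s.rreg a] }

/-- One step of the program `P`; a halted machine does not move. -/
noncomputable def step (b : ℕ) (P : Program) (s : State) : State :=
  match P[s.pc]? with
  | some i => exec b s i
  | none => s

/-- Control has left the program. -/
def Halted (P : Program) (s : State) : Prop := P.length ≤ s.pc

/-- A stored data structure: an array of words and an array of reals. -/
structure Data where
  words : List ℕ
  reals : List ℝ

/-- Space is the total number of cells. -/
def Data.size (D : Data) : ℕ := D.words.length + D.reals.length

/-- Every word of the data structure fits into `b` bits. -/
def Data.Fits (D : Data) (b : ℕ) : Prop := ∀ a ∈ D.words, a < 2 ^ b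

/-- The machine at the start of the query `(x, y)` to `D`: the memory holds `D` followed by zeros,
word registers `0` and `1` hold `x` and `y`, all other registers are zero. -/
noncomputable def initial (D : Data) (x y : ℕ) : State where
  pc := 0
  wreg := fun i => if i = 0 then x else if i = 1 then y else 0
  rreg := fun _ => 0
  wmem := fun i => D.words.getD i 0
  rmem := fun i => D.reals.getD i 0
  wout := []
  rout := []

/-- On the query `(x, y)` to `D`, the program `P` halts after at most `t` steps, its output is the
list `ws` of words and the list `rs` of reals, and the memory is again as it was before. -/
def Answers (b : ℕ) (P : Program) (D : Data) (x y t : ℕ) (ws : List ℕ) (rs : List ℝ) : Prop :=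
  ∃ k ≤ t, ∃ s : State, (step b P)^[k] (initial D x y) = s ∧ Halted P s ∧
    s.wout = ws ∧ s.rout = rs ∧
    s.wmem = (initial D x y).wmem ∧ s.rmem = (initial D x y).rmem

end RealRAM

/-! Deleting e = xy lowers every cut that separates x from y by the same amount w(e) and leaves all
others unchanged. So an optimum of G \ e can be taken to be either a fixed S-mincut of G or a least
Steiner cut of G separating x from y. Least separating cuts for all pairs come from a family of at
most n - 1 cuts (`exists_small_subfamily`): a cheapest cut splitting the vertex set serves every
pair it separates, and its two sides are treated recursively. This needs no submodularity. With the
fixed S-mincut, n cuts suffice for all failures; their vertex lists, an n × n table of pointers to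
them and an n × n table of capacities take quadratic space. -/

namespace SteinerCut

variable {V : Type*}

/-! ### Least cuts separating pairs -/

/-- `C` has exactly one of `x` and `y`. -/
def Separates (C : Finset V) (x y : V) : Prop := ¬(x ∈ C ↔ y ∈ C)

theorem contributes_mk_iff {C : Finset V} {x y : V} :
    Contributes s(x, y) C ↔ Separates C x y := by
  constructor
  · rintro ⟨u, v, h, hu, hv⟩
    rcases Sym2.eq_iff.1 h with ⟨rfl, rfl⟩ | ⟨rfl, rfl⟩ <;> simp [Separates, hu, hv]
  · intro h
    by_cases hx : x ∈ C
    · exact ⟨x, y, rfl, hx, fun hy => h (by simp [hx, hy])⟩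
    · refine ⟨y, x, Sym2.eq_swap, ?_, hx⟩
      by_contra hy
      exact h (by simp [hx, hy])

/-- Among the cuts of a family `𝒞`, fewer than `#A` suffice to contain, for each pair of elements
of `A`, a least cut separating it, whatever the cost function `f` is. -/
theorem exists_small_subfamily [DecidableEq V] (𝒞 : Finset (Finset V)) (f : Finset V → ℝ)
    (A : Finset V) (hA : A.Nonempty) :
    ∃ B ⊆ 𝒞, B.card + 1 ≤ A.card ∧ ∀ x ∈ A, ∀ y ∈ A, ∀ M ∈ 𝒞, Separates M x y →
      ∃ C ∈ B, Separates C x y ∧ f C ≤ f M := by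
  classical
  induction hk : A.card using Nat.strong_induction_on generalizing A with
  | _ k ih =>
    subst hk
    set 𝒟 := 𝒞.filter fun M => ∃ x ∈ A, ∃ y ∈ A, Separates M x y with h𝒟
    rcases 𝒟.eq_empty_or_nonempty with he | hne
    · refine ⟨∅, by simp, by simpa using hA, fun x hx y hy M hM hs => ?_⟩
      have : M ∈ 𝒟 := Finset.mem_filter.2 ⟨hM, x, hx, y, hy, hs⟩
      simp [he] at this
    -- `M₀` is a cheapest cut splitting `A`, hence optimal for each pair of `A` it separates. Any
    -- other pair lies within `A ∩ M₀` or within `A \ M₀`.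
    · obtain ⟨M₀, hM₀, hmin⟩ := 𝒟.exists_min_image f hne
      obtain ⟨hM₀𝒞, a, ha, c, hc, hac⟩ := Finset.mem_filter.1 hM₀
      have h₁ : (A ∩ M₀).Nonempty := by
        by_cases h : a ∈ M₀
        · exact ⟨a, by simp [ha, h]⟩
        · refine ⟨c, Finset.mem_inter.2 ⟨hc, ?_⟩⟩
          by_contra h'
          exact hac (by simp [h, h'])
      have h₂ : (A \ M₀).Nonempty := by
        by_cases h : a ∈ M₀
        · refine ⟨c, Finset.mem_sdiff.2 ⟨hc, fun h' => hac (by simp [h, h'])⟩⟩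
        · exact ⟨a, by simp [ha, h]⟩
      have hcard := Finset.card_inter_add_card_sdiff A M₀
      have p₁ := h₁.card_pos
      have p₂ := h₂.card_pos
      obtain ⟨B₁, hB₁, hB₁c, hB₁m⟩ := ih _ (by omega) _ h₁ rfl
      obtain ⟨B₂, hB₂, hB₂c, hB₂m⟩ := ih _ (by omega) _ h₂ rfl
      refine ⟨insert M₀ (B₁ ∪ B₂), ?_, ?_, ?_⟩
      · exact Finset.insert_subset hM₀𝒞 (Finset.union_subset hB₁ hB₂)
      -- 1 + (|A ∩ M₀| - 1) + (|A \ M₀| - 1) = |A| - 1.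
      · have := Finset.card_insert_le M₀ (B₁ ∪ B₂)
        have := Finset.card_union_le B₁ B₂
        omega
      · intro x hx y hy M hM hs
        by_cases h₀ : Separates M₀ x y
        · exact ⟨M₀, by simp, h₀, hmin M (Finset.mem_filter.2 ⟨hM, x, hx, y, hy, hs⟩)⟩
        · have h₀ : x ∈ M₀ ↔ y ∈ M₀ := not_not.1 h₀
          by_cases hxM : x ∈ M₀
          · obtain ⟨C, hC, h⟩ := hB₁m x (by simp [hx, hxM]) y (by simp [hy, h₀.1 hxM]) M hM hs
            exact ⟨C, by simp [hC], h⟩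
          · obtain ⟨C, hC, h⟩ := hB₂m x (by simp [hx, hxM]) y
              (Finset.mem_sdiff.2 ⟨hy, fun h => hxM (h₀.2 h)⟩) M hM hs
            exact ⟨C, by simp [hC], h⟩

/-! ### Mincuts after an edge failure -/

section Capacity

variable [Fintype V] (G : SimpleGraph V) (w : Sym2 V → ℝ)

theorem capacity_deleteEdges_of_separates {C : Finset V} {x y : V} (hxy : G.Adj x y)
    (h : Separates C x y) :
    capacity (G.deleteEdges {s(x, y)}) w C = capacity G w C - w s(x, y) := by
  classical
  rw [eq_sub_iff_add_eq, capacity, capacity, add_comm]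
  rw [← Finset.sum_insert (by simp)]
  congr 1
  ext e
  simp only [Finset.mem_insert, Finset.mem_filter, Finset.mem_univ, true_and,
    SimpleGraph.edgeSet_deleteEdges, Set.mem_sdiff, Set.mem_singleton_iff]
  constructor
  · rintro (rfl | h')
    · exact ⟨hxy, contributes_mk_iff.2 h⟩
    · exact ⟨h'.1.1, h'.2⟩
  · rintro ⟨h₁, h₂⟩
    by_cases he : e = s(x, y)
    · exact Or.inl he
    · exact Or.inr ⟨⟨h₁, he⟩, h₂⟩

theorem capacity_deleteEdges_of_not_separates {C : Finset V} {x y : V}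
    (h : ¬Separates C x y) :
    capacity (G.deleteEdges {s(x, y)}) w C = capacity G w C := by
  classical
  rw [capacity, capacity]
  congr 1
  ext e
  simp only [Finset.mem_filter, Finset.mem_univ, true_and,
    SimpleGraph.edgeSet_deleteEdges, Set.mem_sdiff, Set.mem_singleton_iff]
  constructor
  · rintro ⟨h₁, h₂⟩
    exact ⟨h₁.1, h₂⟩
  · rintro ⟨h₁, h₂⟩
    refine ⟨⟨h₁, ?_⟩, h₂⟩
    rintro rfl
    exact h (contributes_mk_iff.1 h₂)

/-- At most `n` cuts suffice to contain an `S`-mincut of `G \ {e}` for every edge `e`. -/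
theorem exists_mincuts_deleteEdges (hw : ∀ e ∈ G.edgeSet, 0 ≤ w e) {S : Finset V}
    (hS : 2 ≤ S.card) :
    ∃ B : Finset (Finset V), B.card ≤ Fintype.card V ∧
      ∀ x y, G.Adj x y → ∃ C ∈ B, IsMincut (G.deleteEdges {s(x, y)}) w S C := by
  classical
  obtain ⟨s, hs, s', hs', hne⟩ := Finset.one_lt_card.1 hS
  set 𝒞 : Finset (Finset V) := Finset.univ.filter (IsSteinerCut S)
  have mem𝒞 {C} : C ∈ 𝒞 ↔ IsSteinerCut S C := by simp [𝒞]
  have h𝒞 : 𝒞.Nonempty := ⟨{s}, mem𝒞.2 ⟨s, hs, s', hs', by simp, by simpa using hne.symm⟩⟩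
  obtain ⟨C₀, hC₀, hmin₀⟩ := 𝒞.exists_min_image (capacity G w) h𝒞
  obtain ⟨B, hB, hBcard, hBmin⟩ :=
    exists_small_subfamily 𝒞 (capacity G w) Finset.univ ⟨s, Finset.mem_univ s⟩
  refine ⟨insert C₀ B, (Finset.card_insert_le _ _).trans hBcard, fun x y hxy => ?_⟩
  obtain ⟨M, hM, hminM⟩ := 𝒞.exists_min_image (capacity (G.deleteEdges {s(x, y)}) w) h𝒞
  by_cases hsep : Separates M x y
  · obtain ⟨C, hC, hCs, hCM⟩ := hBmin x (Finset.mem_univ x) y (Finset.mem_univ y) M hM hsep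
    refine ⟨C, by simp [hC], mem𝒞.1 (hB hC), fun C' hC' => ?_⟩
    refine le_trans ?_ (hminM C' (mem𝒞.2 hC'))
    -- Both cuts lose exactly w(e), so their order in G persists.
    rw [capacity_deleteEdges_of_separates G w hxy hCs,
      capacity_deleteEdges_of_separates G w hxy hsep]
    linarith
  · refine ⟨C₀, by simp, mem𝒞.1 hC₀, fun C' hC' => ?_⟩
    refine le_trans ?_ (hminM C' (mem𝒞.2 hC'))
    rw [capacity_deleteEdges_of_not_separates G w hsep]
    -- `M` keeps its capacity, which is at least that of `C₀` in G; as w(e) ≥ 0, the deletion cannot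
    -- raise the capacity of `C₀`.
    refine le_trans ?_ (hmin₀ M hM)
    by_cases h : Separates C₀ x y
    · rw [capacity_deleteEdges_of_separates G w hxy h]
      have : 0 ≤ w s(x, y) := hw _ hxy
      linarith
    · rw [capacity_deleteEdges_of_not_separates G w h]

end Capacity

end SteinerCut

/-! ### The query programs -/

namespace RealRAM

/-- Word `0` is the row length `m` of a table; on the query `(x, y)`, print the list whose
address is stored in row `x` and column `y + 1`. A list is preceded by its end address. -/
def listProgram : Program :=
  [.load 3 2, .mul 4 0 3, .add 4 4 1, .const 5 1, .add 4 4 5, .load 6 4, .load 7 6, .add 6 6 5,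
    .jumpEq 6 7 13, .load 8 6, .emit 8, .add 6 6 5, .jump 8]

/-- Word `0` is the row length `m` of a table of reals; on the query `(x, y)`, print the entry in
row `x` and column `y + 1`. -/
def entryProgram : Program :=
  [.load 3 2, .mul 4 0 3, .add 4 4 1, .const 5 1, .add 4 4 5, .rload 0 4, .remit 0]

/-- Register 6 is the current address, register 7 the end address. A pass through positions 8 to 12
takes five steps and emits one word; the extra step is the exit test. -/
theorem listProgram_loop {b : ℕ} (l : List ℕ) (s : State) (hpc : s.pc = 8)
    (h5 : s.wreg 5 = 1) (h7 : s.wreg 7 = s.wreg 6 + l.length) (hb : s.wreg 7 < 2 ^ b)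
    (hl : ∀ (i : ℕ) (h : i < l.length), s.wmem (s.wreg 6 + i) = l[i]) (hlb : ∀ a ∈ l, a < 2 ^ b) :
    ∃ s' : State, (step b listProgram)^[5 * l.length + 1] s = s' ∧ s'.pc = 13 ∧
      s'.wout = s.wout ++ l ∧ s'.rout = s.rout ∧ s'.wmem = s.wmem ∧ s'.rmem = s.rmem := by
  induction l generalizing s with
  | nil =>
    refine ⟨_, rfl, ?_⟩
    simp only [List.length_nil, Nat.add_zero] at h7
    simp [step, hpc, listProgram, exec, State.branch, h7]
  | cons a l ih =>
    have h0 : s.wmem (s.wreg 6) = a := hl 0 (Nat.succ_pos _)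
    have ha : a < 2 ^ b := hlb a (by simp)
    simp only [List.length_cons] at h7
    have hne : s.wreg 6 ≠ s.wreg 7 := by omega
    have hlt : s.wreg 6 + 1 < 2 ^ b := by omega
    set t : State :=
      { s with
        wreg := Function.update (Function.update s.wreg 8 a) 6 (s.wreg 6 + 1)
        wout := s.wout ++ [a] } with ht
    have hst : (step b listProgram)^[5] s = t := by
      simp [step, hpc, listProgram, exec, State.branch, State.setW, hne, h0, h5, ht,
        Nat.mod_eq_of_lt ha, Nat.mod_eq_of_lt hlt]
    obtain ⟨s', hs', h⟩ := ih t (by simp [ht, hpc]) (by simp [ht, h5])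
      (by simp [ht, h7]; omega) (by simpa [ht] using hb)
      (fun i hi => by
        have := hl (i + 1) (by simpa using hi)
        simpa [ht, add_assoc, add_comm, add_left_comm] using this)
      (fun c hc => hlb c (by simp [hc]))
    refine ⟨s', ?_, h.1, ?_, h.2.2⟩
    · rw [show 5 * (a :: l).length + 1 = (5 * l.length + 1) + 5 by simp; ring,
        Function.iterate_add_apply, hst, hs']
    · rw [h.2.1]
      simp [ht]

/-- Eight set-up instructions precede the loop. The bounds ensure that no intermediate value is
reduced modulo `2 ^ b`. -/
theorem listProgram_answers {b : ℕ} {D : Data} {x y m p : ℕ} {l : List ℕ}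
    (hm : D.words.getD 0 0 = m) (hx : x * m + y + 1 < 2 ^ b) (hmb : m < 2 ^ b) (hb : 1 < 2 ^ b)
    (hp : D.words.getD (x * m + y + 1) 0 = p) (hpl : p + 1 + l.length < 2 ^ b)
    (he : D.words.getD p 0 = p + 1 + l.length)
    (hl : ∀ (i : ℕ) (h : i < l.length), D.words.getD (p + 1 + i) 0 = l[i])
    (hlb : ∀ a ∈ l, a < 2 ^ b) :
    Answers b listProgram D x y (5 * l.length + 9) l [] := by
  have e1 : x * m < 2 ^ b := by omega
  have e2 : x * m + y < 2 ^ b := by omega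
  have e3 : p < 2 ^ b := by omega
  have e4 : p + 1 < 2 ^ b := by omega
  obtain ⟨t, ht, hpc, h5, h6, h7, hwm, hrm, hwo, hro⟩ :
      ∃ t : State, (step b listProgram)^[8] (initial D x y) = t ∧ t.pc = 8 ∧ t.wreg 5 = 1 ∧
        t.wreg 6 = p + 1 ∧ t.wreg 7 = p + 1 + l.length ∧ t.wmem = (initial D x y).wmem ∧
        t.rmem = (initial D x y).rmem ∧ t.wout = [] ∧ t.rout = [] := by
    refine ⟨_, rfl, ?_⟩
    simp only [Function.iterate_succ, Function.iterate_zero, Function.comp_apply, id_eq]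
    simp [step, listProgram, exec, State.setW, initial, -List.getD_eq_getElem?_getD, hm, hp, he,
      Nat.mod_eq_of_lt hx, Nat.mod_eq_of_lt hmb, Nat.mod_eq_of_lt hb, Nat.mod_eq_of_lt hpl,
      Nat.mod_eq_of_lt e1, Nat.mod_eq_of_lt e2, Nat.mod_eq_of_lt e3, Nat.mod_eq_of_lt e4]
  obtain ⟨s', hs', hpc', hwo', hro', hwm', hrm'⟩ :=
    listProgram_loop l t hpc h5 (by rw [h7, h6]) (by rw [h7]; exact hpl)
      (fun i hi => by rw [hwm, h6]; exact hl i hi) hlb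
  refine ⟨5 * l.length + 1 + 8, le_rfl, s', ?_, ?_, ?_, ?_, ?_, ?_⟩
  · rw [Function.iterate_add_apply, ht, hs']
  · simp [Halted, hpc', listProgram]
  · simp [hwo', hwo]
  · rw [hro', hro]
  · rw [hwm', hwm]
  · rw [hrm', hrm]

theorem entryProgram_answers {b : ℕ} {D : Data} {x y m : ℕ} {r : ℝ}
    (hm : D.words.getD 0 0 = m) (hx : x * m + y + 1 < 2 ^ b) (hmb : m < 2 ^ b) (hb : 1 < 2 ^ b)
    (hr : D.reals.getD (x * m + y + 1) 0 = r) :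
    Answers b entryProgram D x y 7 [] [r] := by
  have e1 : x * m < 2 ^ b := by omega
  have e2 : x * m + y < 2 ^ b := by omega
  refine ⟨7, le_rfl, _, rfl, ?_⟩
  simp only [Function.iterate_succ, Function.iterate_zero, Function.comp_apply, id_eq]
  simp [step, entryProgram, exec, State.setW, State.setR, initial, Halted,
    -List.getD_eq_getElem?_getD, hm, hr,
    Nat.mod_eq_of_lt hx, Nat.mod_eq_of_lt hmb, Nat.mod_eq_of_lt hb,
    Nat.mod_eq_of_lt e1, Nat.mod_eq_of_lt e2]

/-! ### Layout of the data structure -/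

/-- The table with `k` rows of length `m` and entries `T`, written row by row. -/
def tabulate {α : Type*} (k m : ℕ) (T : ℕ → ℕ → α) : List α :=
  (List.range (k * m)).map fun a => T (a / m) (a % m)

theorem length_tabulate {α : Type*} (k m : ℕ) (T : ℕ → ℕ → α) :
    (tabulate k m T).length = k * m := by
  simp [tabulate]

theorem getD_tabulate {α : Type*} {k m r c : ℕ} (T : ℕ → ℕ → α) (z : α) (hr : r < k)
    (hc : c < m) : (tabulate k m T).getD (r * m + c) z = T r c := by
  have h : r * m + c < k * m := by nlinarith
  have h₁ : (r * m + c) / m = r := by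
    rw [mul_comm, Nat.mul_add_div (by omega), Nat.div_eq_of_lt hc, add_zero]
  have h₂ : (r * m + c) % m = c := by
    rw [mul_comm, Nat.mul_add_mod, Nat.mod_eq_of_lt hc]
  rw [List.getD_eq_getElem _ _ (by simpa [length_tabulate] using h)]
  simp [tabulate, h₁, h₂]

theorem mem_tabulate {α : Type*} {k m : ℕ} {T : ℕ → ℕ → α} {z : α} (h : z ∈ tabulate k m T) :
    ∃ r < k, ∃ c < m, T r c = z := by
  simp only [tabulate, List.mem_map, List.mem_range] at h
  obtain ⟨a, ha, rfl⟩ := h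
  have hm : 0 < m := Nat.pos_of_ne_zero (by rintro rfl; simp at ha)
  exact ⟨a / m, (Nat.div_lt_iff_lt_mul hm).2 ha, a % m, Nat.mod_lt _ hm, rfl⟩

/-- The words stored for the lists `l 0, …, l (n - 1)` and the choice `j x y` among them: `n` rows
of addresses, with the row length in front, and `n` rows of lists preceded by end addresses. -/
def wordTable (n : ℕ) (l : ℕ → List ℕ) (j : ℕ → ℕ → ℕ) (r c : ℕ) : ℕ :=
  if r < n then if c = 0 then n + 1 else (n + j r (c - 1)) * (n + 1)
  else if c = 0 then r * (n + 1) + 1 + (l (r - n)).length else (l (r - n)).getD (c - 1) 0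

/-- Constant-time access to one of `n` lists of at most `n` words and to a real number for each
of the pairs `(x, y)`, in quadratic space. -/
theorem exists_data {n : ℕ} (l : ℕ → List ℕ) (j : ℕ → ℕ → ℕ) (c : ℕ → ℕ → ℝ) (hn : 0 < n)
    (hlen : ∀ i, (l i).length ≤ n) (hl : ∀ i, ∀ a ∈ l i, a < n) (hj : ∀ x y, j x y < n) :
    ∃ D : Data, D.size ≤ 3 * (n * (n + 1)) ∧ D.Fits (3 * (Nat.log 2 n + 1)) ∧
      ∀ b, 3 * (Nat.log 2 n + 1) ≤ b → ∀ x < n, ∀ y < n,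
        Answers b listProgram D x y (5 * (l (j x y)).length + 9) (l (j x y)) [] ∧
        Answers b entryProgram D x y 7 [] [c x y] := by
  have hlog : n + 1 ≤ 2 ^ (Nat.log 2 n + 1) := Nat.lt_pow_succ_log_self (by norm_num) n
  -- All stored words are at most 2n(n + 1) < (n + 1)³, whence the factor 3 in the word length.
  have hbig : (2 * n) * (n + 1) < 2 ^ (3 * (Nat.log 2 n + 1)) := by
    rw [mul_comm 3, pow_mul]
    calc (2 * n) * (n + 1) < (n + 1) ^ 3 := by
          have : 2 * n < (n + 1) ^ 2 := by nlinarith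
          calc (2 * n) * (n + 1) < (n + 1) ^ 2 * (n + 1) := by gcongr
            _ = (n + 1) ^ 3 := by ring
      _ ≤ _ := by gcongr
  have hrow {r : ℕ} (hr : r < 2 * n) : r * (n + 1) + (n + 1) ≤ 2 * n * (n + 1) := by
    have : (r + 1) * (n + 1) ≤ 2 * n * (n + 1) := by gcongr; omega
    linarith
  -- Column 0 of the real table is padding, so that both programs compute the same address.
  refine ⟨⟨tabulate (2 * n) (n + 1) (wordTable n l j),
    tabulate n (n + 1) fun r k => c r (k - 1)⟩, ?_, ?_, fun b hb x hx y hy => ?_⟩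
  · simp only [Data.size, length_tabulate]
    exact le_of_eq (by ring)
  · intro a ha
    obtain ⟨r, hr, k, hk, rfl⟩ := mem_tabulate ha
    refine lt_of_le_of_lt ?_ hbig
    unfold wordTable
    split_ifs with h₁ h₂ h₂
    · nlinarith
    · have := hj r (k - 1)
      have := hrow (r := n + j r (k - 1)) (by omega)
      omega
    · have := hlen (r - n)
      have := hrow hr
      omega
    · have : (l (r - n)).getD (k - 1) 0 ≤ n := by
        by_cases hlt : k - 1 < (l (r - n)).length
        · rw [List.getD_eq_getElem _ _ hlt]
          exact (hl _ _ (List.getElem_mem hlt)).le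
        · rw [List.getD_eq_default _ _ (by omega)]
          omega
      nlinarith
  have hbig : (2 * n) * (n + 1) < 2 ^ b :=
    hbig.trans_le (Nat.pow_le_pow_right (by norm_num) hb)
  have hxrow := hrow (r := x) (by omega)
  have hjn := hj x y
  have hjrow := hrow (r := n + j x y) (by omega)
  have hjlen := hlen (j x y)
  have h0 : (tabulate (2 * n) (n + 1) (wordTable n l j)).getD 0 0 = n + 1 := by
    have := getD_tabulate (wordTable n l j) 0 (show 0 < 2 * n by omega) (show 0 < n + 1 by omega)
    simpa [wordTable, hn] using this
  constructor
  · refine listProgram_answers h0 (p := (n + j x y) * (n + 1)) (by omega) (by omega) (by omega)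
      ?_ (by omega) ?_ (fun i hi => ?_) (fun a ha => ?_)
    · rw [add_assoc, getD_tabulate _ _ (by omega) (by omega)]
      simp [wordTable, hx]
    · have := getD_tabulate (wordTable n l j) 0 (show n + j x y < 2 * n by omega)
        (show 0 < n + 1 by omega)
      simpa [wordTable] using this
    · rw [add_assoc, getD_tabulate _ _ (by omega) (by omega), add_comm 1 i]
      simp [wordTable, hi]
    · have := hl _ a ha
      omega
  · refine entryProgram_answers h0 (by omega) (by omega) (by omega) ?_
    rw [add_assoc, getD_tabulate _ _ hx (by omega)]
    simp

end RealRAM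

/-! ### The main theorem -/

theorem mainTheorem4 :
    ∃ (cutQuery capQuery : RealRAM.Program) (K : ℕ),
      ∀ (n : ℕ) (G : SimpleGraph (Fin n)) (w : Sym2 (Fin n) → ℝ),
        (∀ e ∈ G.edgeSet, 0 ≤ w e) →
        ∀ S : Finset (Fin n), 2 ≤ S.card →
          ∃ D : RealRAM.Data,
            D.size ≤ K * n ^ 2 ∧
            D.Fits (K * (Nat.log 2 n + 1)) ∧
            ∀ x y : Fin n, G.Adj x y →
              ∃ (C : Finset (Fin n)) (L : List (Fin n)),
                SteinerCut.IsMincut (G.deleteEdges {s(x, y)}) w S C ∧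
                L.Nodup ∧ (∀ v : Fin n, v ∈ L ↔ v ∈ C) ∧
                RealRAM.Answers (K * (Nat.log 2 n + 1)) cutQuery D x y (K * C.card)
                  (L.map Fin.val) [] ∧
                RealRAM.Answers (K * (Nat.log 2 n + 1)) capQuery D x y K
                  [] [SteinerCut.capacity (G.deleteEdges {s(x, y)}) w C] := by
  classical
  -- 14 = 5 + 9: the bound 5|C| + 9 is at most 14|C| because a Steiner cut is nonempty.
  refine ⟨RealRAM.listProgram, RealRAM.entryProgram, 14, fun n G w hw S hS => ?_⟩
  have hn : 2 ≤ n := by simpa using hS.trans (Finset.card_le_univ S)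
  obtain ⟨B, hB, hmin⟩ := SteinerCut.exists_mincuts_deleteEdges G w hw hS
  rw [Fintype.card_fin] at hB
  let cut : ℕ → Finset (Fin n) := fun i => B.toList.getD i ∅
  -- The index must be below n for every pair, so non-edges get the arbitrary value 0.
  have hindex : ∀ x y : ℕ, ∃ i < n, ∀ (hx : x < n) (hy : y < n), G.Adj ⟨x, hx⟩ ⟨y, hy⟩ →
      SteinerCut.IsMincut (G.deleteEdges {s(⟨x, hx⟩, ⟨y, hy⟩)}) w S (cut i) := by
    intro x y
    by_cases h : ∃ (hx : x < n) (hy : y < n), G.Adj ⟨x, hx⟩ ⟨y, hy⟩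
    · obtain ⟨hx, hy, hxy⟩ := h
      obtain ⟨C, hC, hCmin⟩ := hmin _ _ hxy
      obtain ⟨i, hi, hiC⟩ := List.getElem_of_mem (Finset.mem_toList.2 hC)
      refine ⟨i, ?_, fun _ _ _ => ?_⟩
      · rw [Finset.length_toList] at hi
        omega
      · simpa only [cut, List.getD_eq_getElem _ _ hi, hiC] using hCmin
    · exact ⟨0, by omega, fun hx hy hxy => absurd ⟨hx, hy, hxy⟩ h⟩
  choose j hj hjmin using hindex
  let c : ℕ → ℕ → ℝ := fun x y => if h : x < n ∧ y < n then
    SteinerCut.capacity (G.deleteEdges {s(⟨x, h.1⟩, ⟨y, h.2⟩)}) w (cut (j x y)) else 0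
  obtain ⟨D, hsize, hfits, hans⟩ := RealRAM.exists_data
    (fun i => (cut i).toList.map Fin.val) j c (by omega)
    (fun i => by simpa using Finset.card_le_univ (cut i))
    (fun i a ha => by
      obtain ⟨v, -, rfl⟩ := List.mem_map.1 ha
      exact v.2) hj
  have hb : 3 * (Nat.log 2 n + 1) ≤ 14 * (Nat.log 2 n + 1) := by omega
  refine ⟨D, hsize.trans (by nlinarith), fun a ha => (hfits a ha).trans_le
    (Nat.pow_le_pow_right (by norm_num) hb), fun x y hxy => ?_⟩
  have hC := hjmin x y x.2 y.2 hxy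
  obtain ⟨h₁, h₂⟩ := hans _ hb x x.2 y y.2
  refine ⟨cut (j x y), (cut (j x y)).toList, hC, Finset.nodup_toList _,
    fun v => Finset.mem_toList, ?_, ?_⟩
  · obtain ⟨⟨s, -, -, -, hs, -⟩, -⟩ := hC
    have hpos : 0 < (cut (j x y)).card := Finset.card_pos.2 ⟨s, hs⟩
    obtain ⟨k, hk, h⟩ := h₁
    refine ⟨k, hk.trans ?_, h⟩
    simp only [List.length_map, Finset.length_toList]
    omega
  · obtain ⟨k, hk, h⟩ := h₂
    refine ⟨k, hk.trans (by norm_num), ?_⟩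
    simpa only [c, x.2, y.2, and_self, dite_true] using h
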